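/- Call a category elementary if there are a set-sized, one-sorted, finitary first-order signature $L$ and a first-order $L$-theory $T$ such that the category is equivalent to $\mathbf{Mod}(T)$, the category whose objects are the models of $T$ (the empty structure being admitted if it satisfies $T$) and whose morphisms are all $L$-homomorphisms, i.e. maps that commute with the function symbols and preserve, but need not reflect, the relation symbols. Let $\mathbf{KH}$ be the category of compact Hausdorff spaces and continuous maps, and let $\mathbf{CC^*Alg}$ be the category of commutative unital complex $C^*$-algebras and unit-preserving $*$-homomorphisms. Then $\mathbf{KH}^{\mathrm{op}}$ is not elementary. Moreover, $\mathbf{KH}^{\mathrm{op}}$ is equivalent to $\mathbf{CC^*Alg}$, and $\mathbf{CC^*Alg}$ is not elementary either. -/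

import Mathlib

open CategoryTheory

universe u v w

/-- An object of the category `Mod(T)`: a set carrying an `L`-structure that satisfies every
sentence of `T`. As is usual in category theory, an empty structure is admitted if it satisfies
`T`; a convention that excludes it is recovered by adding the sentence `∃ x, ⊤` to `T`. -/
structure ModelCat {L : FirstOrder.Language.{u, u}} (T : L.Theory) : Type (u + 1) where
  carrier : Type u
  [struc : L.Structure carrier]
  [isModel : carrier ⊨ T]

namespace ModelCat

attribute [instance] struc isModel

/-- The category `Mod(T)` of models of `T` and all homomorphisms, i.e. maps that commute with the
function symbols and preserve (but need not reflect) the relation symbols. -/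
instance {L : FirstOrder.Language.{u, u}} (T : L.Theory) : Category.{u} (ModelCat T) where
  Hom M N := L.Hom M.carrier N.carrier
  id M := FirstOrder.Language.Hom.id L M.carrier
  comp f g := FirstOrder.Language.Hom.comp g f

end ModelCat

/-- A category is elementary if it is equivalent to the category `Mod(T)` of some first-order
theory `T`. The universe `Type u` plays the role of the universe of sets: the signature and the
underlying sets of the models live in it. -/
def IsElementary (C : Type v) [Category.{w} C] : Prop :=
  ∃ (L : FirstOrder.Language.{u, u}) (T : L.Theory), Nonempty (C ≌ ModelCat T)

/-- A commutative unital C⋆-algebra over `ℂ` (the zero algebra is included). -/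
structure CCStarAlg : Type (u + 1) where
  carrier : Type u
  [str : CommCStarAlgebra carrier]

namespace CCStarAlg

attribute [instance] str

/-- The category of commutative unital C⋆-algebras and unit-preserving ⋆-homomorphisms. -/
instance : Category.{u} CCStarAlg.{u} where
  Hom A B := A.carrier →⋆ₐ[ℂ] B.carrier
  id A := StarAlgHom.id ℂ A.carrier
  comp f g := g.comp f

end CCStarAlg

/-! Let `F` be a faithful functor from `KHᵒᵖ` to `Mod(T)` that preserves filtered colimits. An
element `x` of `F X` defines a function on `X` with values in `F pt`, sending a point `a : pt ⟶ X`
to `F a x`, and by faithfulness these functions separate the points of `X`.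

In `Mod(T)` a filtered colimit of nonempty models is covered by the members of the diagram, because
it can be compared with their ultraproduct. A profinite space is the filtered colimit in `KHᵒᵖ` of
its finite discrete quotients, so each `x` comes from such a quotient and its function is locally
constant. As every compact Hausdorff space is a quotient of a profinite one, the functions are
locally constant on all `X`. On the unit interval they are therefore constant, and cannot separate
`0` from `1`.
-/

open Filter Limits Opposite

section Ultraproduct

open FirstOrder FirstOrder.Language Structure

variable {L : Language} {α : Type*} {M N : α → Type*} [∀ a, L.Structure (M a)]
  [∀ a, L.Structure (N a)] {U : Ultrafilter α}

theorem relMap_ultraproduct_cast {n : ℕ} (r : L.Relations n) (x : Fin n → ∀ a, M a) :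
    (RelMap r fun i => (x i : (U : Filter α).Product M)) ↔
      ∀ᶠ a in U, RelMap r fun i => x i a := by
  apply relMap_quotient_mk'

theorem exists_eq_ultraproduct_cast {ι : Type*} (x : ι → (U : Filter α).Product M) :
    ∃ y : ι → ∀ a, M a, x = fun i => (y i : (U : Filter α).Product M) :=
  ⟨fun i => (x i).out, funext fun i => (Quotient.out_eq (x i)).symm⟩

/-- The homomorphism into an ultraproduct induced by a family of maps into the factors. The maps
need not be homomorphisms: each instance of the compatibility with a symbol is only required on a
set of indices that belongs to the ultrafilter, and this set may depend on the instance. -/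
def homUltraproduct {A : Type*} [L.Structure A] (h : ∀ a, A → M a)
    (hfun : ∀ {n : ℕ} (f : L.Functions n) (x : Fin n → A),
      ∀ᶠ a in U, h a (funMap f x) = funMap f fun i => h a (x i))
    (hrel : ∀ {n : ℕ} (r : L.Relations n) (x : Fin n → A), RelMap r x →
      ∀ᶠ a in U, RelMap r fun i => h a (x i)) :
    A →[L] (U : Filter α).Product M where
  toFun x := ((fun a => h a x : ∀ a, M a) : (U : Filter α).Product M)
  map_fun' f x :=
    (Quotient.sound (hfun f x)).trans (Ultraproduct.funMap_cast f fun i a => h a (x i)).symm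
  map_rel' r x hx := (relMap_ultraproduct_cast r fun i a => h a (x i)).2 (hrel r x hx)

/-- The homomorphism of ultraproducts induced by a family of homomorphisms of the factors. -/
def ultraproductMap (U : Ultrafilter α) (h : ∀ a, M a →[L] N a) :
    (U : Filter α).Product M →[L] (U : Filter α).Product N where
  toFun := Quotient.map (fun x a => h a (x a)) fun _ _ hxy => hxy.mono fun a => congrArg (h a)
  map_fun' f x := by
    obtain ⟨y, rfl⟩ := exists_eq_ultraproduct_cast x
    refine (congrArg _ (Ultraproduct.funMap_cast f y)).trans <| .trans ?_
      (Ultraproduct.funMap_cast f fun i a => h a (y i a)).symm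
    exact Quotient.sound (.of_forall fun a => (h a).map_fun f fun i => y i a)
  map_rel' r x hx := by
    obtain ⟨y, rfl⟩ := exists_eq_ultraproduct_cast x
    exact (relMap_ultraproduct_cast r fun i a => h a (y i a)).2
      (((relMap_ultraproduct_cast r y).1 hx).mono fun a => (h a).map_rel r _)

end Ultraproduct

namespace ModelCat

variable {L : FirstOrder.Language.{u, u}} {T : L.Theory}

instance : ConcreteCategory (ModelCat T) fun M N => L.Hom M.carrier N.carrier where
  hom f := f
  ofHom f := f

/-- The ultraproduct of a family of nonempty models of `T`, which is a model of `T` by Łoś's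
theorem. -/
def ultraproduct {J : Type u} (U : Ultrafilter J) (M : J → ModelCat T)
    [∀ j, Nonempty (M j).carrier] : ModelCat T where
  carrier := (U : Filter J).Product fun j => (M j).carrier
  isModel := ⟨fun φ hφ => (FirstOrder.Language.Ultraproduct.sentence_realize φ).2
    (Eventually.of_forall fun j => (M j).isModel.realize_of_mem φ hφ)⟩

/-- The diagonal homomorphism of a model into its ultrapower. -/
def diagonal {J : Type u} (U : Ultrafilter J) (M : ModelCat T) [Nonempty M.carrier] :
    M ⟶ ultraproduct U fun _ => M :=
  homUltraproduct (fun _ y => y) (fun _ _ => .of_forall fun _ => rfl)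
    fun _ _ h => .of_forall fun _ => h

section Directed

variable {J : Type u} [Preorder J] (F : J ⥤ ModelCat T) [∀ j, Nonempty (F.obj j).carrier]

open Classical in
/-- The transition maps of a diagram of nonempty models, extended to all pairs of indices by an
arbitrary constant map when `i ≤ j` fails. -/
noncomputable def transition (i j : J) (y : (F.obj i).carrier) : (F.obj j).carrier :=
  if h : i ≤ j then F.map (homOfLE h) y else Classical.arbitrary _

theorem transition_of_le {i j : J} (h : i ≤ j) (y : (F.obj i).carrier) :
    transition F i j y = F.map (homOfLE h) y :=
  dif_pos h

/-- The cocone over a diagram of nonempty models whose point is the ultraproduct of the diagram. An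
element of `F.obj i` is sent to the class of its images under the transition maps, which are
meaningful at almost all indices because the ultrafilter contains every set `{j | i ≤ j}`. -/
noncomputable def ultraproductCocone {U : Ultrafilter J} (hU : (U : Filter J) ≤ atTop) :
    Cocone F where
  pt := ultraproduct U F.obj
  ι :=
    { app i := homUltraproduct (transition F i)
        (fun f y => ((eventually_ge_atTop i).filter_mono hU).mono fun j h => by
          simp only [transition_of_le F h]
          exact (F.map (homOfLE h)).map_fun' f y)
        (fun r y hy => ((eventually_ge_atTop i).filter_mono hU).mono fun j h => by
          simp only [transition_of_le F h]
          exact (F.map (homOfLE h)).map_rel' r y hy)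
      naturality i j f := ConcreteCategory.hom_ext _ _ fun y =>
        Quotient.sound <| ((eventually_ge_atTop j).filter_mono hU).mono fun k h => by
          change transition F j k (F.map f y) = transition F i k y
          rw [transition_of_le F h, transition_of_le F (f.le.trans h), ← comp_apply,
            ← F.map_comp]
          rfl }

variable {F}

theorem exists_rep_of_isColimit_of_directed [IsDirectedOrder J] [Nonempty J] {c : Cocone F}
    (hc : IsColimit c) (x : c.pt.carrier) :
    ∃ (j : J) (y : (F.obj j).carrier), c.ι.app j y = x := by
  let U : Ultrafilter J := .of atTop
  have hU : (U : Filter J) ≤ atTop := Ultrafilter.of_le atTop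
  have : Nonempty c.pt.carrier := ⟨x⟩
  let d : c.pt ⟶ ultraproduct U F.obj := hc.desc (ultraproductCocone F hU)
  let g : ultraproduct U F.obj ⟶ ultraproduct U fun _ => c.pt :=
    ultraproductMap U fun j => c.ι.app j
  -- The values of `g` are represented by families of elements in the images of the members of the
  -- diagram, so it suffices to identify `d ≫ g` with the diagonal.
  have hd : d ≫ g = diagonal U c.pt := by
    refine hc.hom_ext fun i => ?_
    have hdi : c.ι.app i ≫ d = (ultraproductCocone F hU).ι.app i := hc.fac _ i
    rw [← Category.assoc, hdi]
    refine ConcreteCategory.hom_ext _ _ fun y => Quotient.sound <|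
      ((eventually_ge_atTop i).filter_mono hU).mono fun j h => ?_
    change c.ι.app j (transition F i j y) = c.ι.app i y
    rw [transition_of_le F h, ← comp_apply, c.w]
  obtain ⟨z, hz⟩ := Quotient.exists_rep (d x)
  have hx : g (d x) = diagonal U c.pt x := ConcreteCategory.congr_hom hd x
  rw [← hz] at hx
  obtain ⟨j, hj⟩ := (Quotient.exact hx : ∀ᶠ j in (U : Filter J), c.ι.app j (z j) = x).exists
  exact ⟨j, z j, hj⟩

end Directed

theorem exists_rep_of_isColimit {J : Type u} [SmallCategory J] [IsFiltered J]
    {F : J ⥤ ModelCat T} [∀ j, Nonempty (F.obj j).carrier] {c : Cocone F} (hc : IsColimit c)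
    (x : c.pt.carrier) : ∃ (j : J) (y : (F.obj j).carrier), c.ι.app j y = x := by
  obtain ⟨I, _, _, _, P, _⟩ := IsFiltered.exists_directed J
  have (i : I) : Nonempty ((P ⋙ F).obj i).carrier :=
    inferInstanceAs (Nonempty (F.obj (P.obj i)).carrier)
  obtain ⟨i, y, hy⟩ :=
    exists_rep_of_isColimit_of_directed ((Functor.Final.isColimitWhiskerEquiv P c).symm hc) x
  exact ⟨P.obj i, y, hy⟩

end ModelCat

section PointEval

variable (G : CompHaus.{u}ᵒᵖ ⥤ Type w) {X Y : CompHaus.{u}}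

/-- For a set-valued contravariant functor `G` on compact Hausdorff spaces, an element `x` of `G X`
restricts along each point of `X` to an element of `G pt`. This views `x` as a function on `X`. -/
def pointEval (x : G.obj (op X)) (a : X) : G.obj (op (CompHaus.of PUnit)) :=
  G.map (CompHausLike.const _ a).op x

theorem pointEval_map (f : X ⟶ Y) (y : G.obj (op Y)) :
    pointEval G (G.map f.op y) = pointEval G y ∘ f := by
  ext a
  simp only [pointEval, Function.comp_apply, ← CompHausLike.const_comp, op_comp, G.map_comp,
    comp_apply]

theorem isLocallyConstant_pointEval_map [DiscreteTopology Y] (f : X ⟶ Y) (y : G.obj (op Y)) :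
    IsLocallyConstant (pointEval G (G.map f.op y)) := by
  rw [pointEval_map]
  exact (IsLocallyConstant.of_discrete _).comp_continuous (map_continuous f.hom.hom)

theorem isLocallyConstant_pointEval_of_epi (f : Y ⟶ X) [Epi f] {x : G.obj (op X)}
    (hx : IsLocallyConstant (pointEval G (G.map f.op x))) : IsLocallyConstant (pointEval G x) := by
  have hf : Topology.IsQuotientMap f :=
    .of_surjective_continuous ((CompHaus.epi_iff_surjective f).1 ‹_›) (map_continuous f.hom.hom)
  rw [pointEval_map] at hx
  exact fun s => hf.isOpen_preimage.1 (hx s)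

theorem eq_of_forall_pointEval_eq [G.Faithful] {a b : X}
    (h : ∀ x : G.obj (op X), pointEval G x a = pointEval G x b) : a = b := by
  have hab : (CompHausLike.const (CompHaus.of PUnit.{u + 1}) a).op =
      (CompHausLike.const (CompHaus.of PUnit) b).op := G.map_injective (by ext x; exact h x)
  exact ConcreteCategory.congr_hom (Quiver.Hom.op_inj hab) PUnit.unit

theorem nonempty_obj_of_faithful [G.Faithful] (X : CompHaus.{u}ᵒᵖ) : Nonempty (G.obj X) := by
  let B : CompHaus.{u} := CompHaus.of (ULift Bool)
  have hB : Nonempty (G.obj (op B)) := by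
    by_contra! h
    have : (⟨false⟩ : B) = ⟨true⟩ := eq_of_forall_pointEval_eq G h.elim
    exact Bool.false_ne_true (congrArg ULift.down this)
  exact hB.map (G.map (CompHausLike.const X.unop (⟨false⟩ : B)).op)

end PointEval

section Models

variable {L : FirstOrder.Language.{u, u}} {T : L.Theory} (F : CompHaus.{u}ᵒᵖ ⥤ ModelCat T)
  [F.Faithful] [PreservesFilteredColimitsOfSize.{u, u} F]

theorem isLocallyConstant_pointEval_of_profinite (X : Profinite.{u})
    (x : (F ⋙ forget (ModelCat T)).obj (op (profiniteToCompHaus.obj X))) :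
    IsLocallyConstant (pointEval (F ⋙ forget (ModelCat T)) x) := by
  let c := (profiniteToCompHaus.mapCone X.asLimitCone).op
  have hc : IsColimit (F.mapCocone c) :=
    isColimitOfPreserves F (isLimitOfPreserves profiniteToCompHaus X.asLimit).op
  have (Q : (DiscreteQuotient X)ᵒᵖ) :
      Nonempty (((X.diagram ⋙ profiniteToCompHaus).op ⋙ F).obj Q).carrier :=
    nonempty_obj_of_faithful (F ⋙ forget (ModelCat T)) _
  obtain ⟨Q, y, rfl⟩ := ModelCat.exists_rep_of_isColimit hc x
  have : DiscreteTopology (profiniteToCompHaus.obj (X.diagram.obj Q.unop)) := ⟨rfl⟩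
  exact isLocallyConstant_pointEval_map (F ⋙ forget (ModelCat T))
    (profiniteToCompHaus.map (X.asLimitCone.π.app Q.unop)) y

theorem isLocallyConstant_pointEval (X : CompHaus.{u})
    (x : (F ⋙ forget (ModelCat T)).obj (op X)) :
    IsLocallyConstant (pointEval (F ⋙ forget (ModelCat T)) x) :=
  isLocallyConstant_pointEval_of_epi _ (CompHaus.presentation.π X) <|
    isLocallyConstant_pointEval_of_profinite F (Stonean.toProfinite.obj X.presentation) _

end Models

theorem not_faithful_of_preservesFilteredColimits {L : FirstOrder.Language.{u, u}} {T : L.Theory}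
    (F : CompHaus.{u}ᵒᵖ ⥤ ModelCat T) [PreservesFilteredColimitsOfSize.{u, u} F] :
    ¬ F.Faithful := by
  intro _
  let I : CompHaus.{u} := CompHaus.of (ULift unitInterval)
  have : PreconnectedSpace I := ULift.up_surjective.denseRange.preconnectedSpace continuous_uliftUp
  have h : (⟨0⟩ : I) = ⟨1⟩ := eq_of_forall_pointEval_eq (F ⋙ forget (ModelCat T)) fun x =>
    (isLocallyConstant_pointEval F I x).apply_eq_of_preconnectedSpace _ _
  exact zero_ne_one (congrArg ULift.down h)

theorem not_isElementary_op_compHaus : ¬ IsElementary.{u} CompHaus.{u}ᵒᵖ :=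
  fun ⟨_, _, ⟨e⟩⟩ => not_faithful_of_preservesFilteredColimits e.functor inferInstance

theorem IsElementary.of_equivalence {C : Type*} [Category* C] {D : Type*} [Category* D]
    (h : IsElementary.{u} C) (e : C ≌ D) : IsElementary.{u} D := by
  obtain ⟨L, T, ⟨F⟩⟩ := h
  exact ⟨L, T, ⟨e.symm.trans F⟩⟩

namespace CCStarAlg

open WeakDual CharacterSpace

/-- The contravariant functor `X ↦ C(X, ℂ)`. -/
noncomputable def continuousFunctions : CompHaus.{u}ᵒᵖ ⥤ CCStarAlg.{u} where
  obj X := { carrier := C(X.unop, ℂ) }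
  map f := ContinuousMap.compStarAlgHom' ℂ ℂ f.unop.hom.hom

/-- The contravariant functor sending an algebra to its Gelfand spectrum. -/
noncomputable def characters : CCStarAlg.{u} ⥤ CompHaus.{u}ᵒᵖ where
  obj A := op (CompHaus.of (characterSpace ℂ A.carrier))
  map {A B} f := Quiver.Hom.op (X := CompHaus.of (characterSpace ℂ B.carrier))
    (Y := CompHaus.of (characterSpace ℂ A.carrier)) (CompHausLike.ofHom _ (compContinuousMap f))

/-- The isomorphism in `CCStarAlg` given by a ⋆-algebra isomorphism. -/
def isoOfStarAlgEquiv {A B : CCStarAlg.{u}} (e : A.carrier ≃⋆ₐ[ℂ] B.carrier) : A ≅ B where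
  hom := (e : A.carrier →⋆ₐ[ℂ] B.carrier)
  inv := (e.symm : B.carrier →⋆ₐ[ℂ] A.carrier)
  hom_inv_id := StarAlgHom.ext e.symm_apply_apply
  inv_hom_id := StarAlgHom.ext e.apply_symm_apply

/-- The natural isomorphism between `X` and the space of characters of `C(X, ℂ)`, which sends a
point to the evaluation at that point. -/
noncomputable def evalIso : continuousFunctions.{u} ⋙ characters ≅ 𝟭 _ :=
  NatIso.ofComponents fun X => (CompHausLike.isoOfHomeo (X := X.unop)
    (Y := (characters.obj (continuousFunctions.obj X)).unop) (homeoEval X.unop ℂ)).op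

/-- The Gelfand transform `A ≅ C(Â, ℂ)`, as a natural isomorphism. -/
noncomputable def gelfandIso : 𝟭 _ ≅ characters.{u} ⋙ continuousFunctions :=
  NatIso.ofComponents fun A =>
    isoOfStarAlgEquiv (B := { carrier := C(characterSpace ℂ A.carrier, ℂ) })
      (gelfandStarTransform A.carrier)

/-- Gelfand duality between compact Hausdorff spaces and commutative unital C⋆-algebras. -/
noncomputable def gelfandDuality : CompHaus.{u}ᵒᵖ ≌ CCStarAlg.{u} :=
  .mk continuousFunctions characters evalIso.symm gelfandIso.symm

end CCStarAlg

theorem corollary3p3 :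
    ¬ IsElementary.{u} CompHaus.{u}ᵒᵖ ∧
      Nonempty (CompHaus.{u}ᵒᵖ ≌ CCStarAlg.{u}) ∧
      ¬ IsElementary.{u} CCStarAlg.{u} :=
  ⟨not_isElementary_op_compHaus, ⟨CCStarAlg.gelfandDuality⟩, fun h =>
    not_isElementary_op_compHaus (h.of_equivalence CCStarAlg.gelfandDuality.symm)⟩
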